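/- Let $\mathsf X$ be a measurable space, let $n,p\ge 0$ be integers, $\sigma\ge 0$, let $\mathsf W\subseteq\mathbb R^p$ be convex, and let $g:\mathsf X\times\mathsf W\to\mathbb R$ be a measurable function such that $g(x,\cdot)$ is differentiable on $\mathsf W$ (relative to $\mathsf W$) for every $x$, with gradient $\nabla_w g(x,w)$. Let $P_W$ be a probability distribution on $\mathsf W$ and $P_X$ one on $\mathsf X$. For $w\in\mathsf W$ let $P_{Z|W=w}$ be the distribution of $(X, g(X,w)+V)$, where $X\sim P_X$ and $V\sim\mathcal N(0,\sigma^2)$ are independent. Let the parameter $W$, the data $Z^n=(Z_1,\dots,Z_n)$ and the fresh sample $Z=(X,Y)$ have the joint distribution $$P_{W,Z^n,Z}=P_W\otimes\Big(\prod_{i=1}^n P_{Z_i|W}\Big)\otimes P_{Z|W},\qquad P_{Z_i|W}=P_{Z|W};$$ that is, $Y=g(X,W)+V$ with $X$ independent of $W$ and $V\sim\mathcal N(0,\sigma^2)$ independent of $(X,W)$, and given $W$ the samples $Z_1,\dots,Z_n,Z$ are i.i.d. For random vectors $S$ in $\mathbb R^k$ and an observation $U$, let $$H_2(S|U)=\inf_{\psi}\mathbb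 E\big[\|S-\psi(U)\|^2\big]\in[0,\infty],$$ where $\psi$ ranges over all measurable maps into $\mathbb R^k$ (so $H_2(W|Z^n)$ is the minimum mean square error of estimating $W$ from $Z^n$). Define the minimum excess risk under the quadratic loss by $$\mathrm{MER}_2=H_2(Y|X,Z^n)-H_2(Y|X,W),$$ and let $s_g^2=\mathbb E\big[\sup_{w\in\mathsf W}\|\nabla_w g(X,w)\|^2\big]\in[0,\infty]$. Then $$\mathrm{MER}_2\le\sqrt{4\sigma^2 s_g^2\,H_2(W|Z^n)}+2s_g^2\,H_2(W|Z^n),$$ where the right-hand side is computed in $[0,\infty]$ with $0\cdot\infty=0$. -/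

import Mathlib

open MeasureTheory ProbabilityTheory
open scoped NNReal ENNReal

noncomputable section

namespace BayesLearning

/-- Generalized conditional entropy (Bayes risk) `H_ℓ(Y | U)` of `Y` given the observation `U`, for a
nonnegative loss `ℓ`: the infimum of the expected loss `E[ℓ(Y, ψ(U))]` over all measurable decision
rules `ψ`. The loss being nonnegative, every expectation is well defined in `[0, ∞]`. -/
def condEntropy {Ω S 𝓤 A : Type*} [MeasurableSpace Ω] [MeasurableSpace 𝓤] [MeasurableSpace A]
    (ℓ : S → A → ℝ≥0∞) (Y : Ω → S) (U : Ω → 𝓤) (P : Measure Ω) : ℝ≥0∞ :=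
  ⨅ (ψ : 𝓤 → A) (_ : Measurable ψ), ∫⁻ ω, ℓ (Y ω) (ψ (U ω)) ∂P

/-- The quadratic loss `ℓ(y, a) = ‖y - a‖²`. -/
def quadLoss {F : Type*} [NormedAddCommGroup F] (y a : F) : ℝ≥0∞ := ‖y - a‖ₑ ^ 2

/-- Minimum excess risk `MER_ℓ = H_ℓ(Y | X, Zⁿ) - H_ℓ(Y | X, W)`, as an extended real number. -/
def minExcessRisk {Ω 𝓦 𝓩 𝓧 S A : Type*} [MeasurableSpace Ω] [MeasurableSpace 𝓦]
    [MeasurableSpace 𝓩] [MeasurableSpace 𝓧] [MeasurableSpace A] (ℓ : S → A → ℝ≥0∞)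
    (W : Ω → 𝓦) (Zn : Ω → 𝓩) (X : Ω → 𝓧) (Y : Ω → S) (P : Measure Ω) : EReal :=
  ((condEntropy ℓ Y (fun ω => (X ω, Zn ω)) P : ℝ≥0∞) : EReal)
    - ((condEntropy ℓ Y (fun ω => (X ω, W ω)) P : ℝ≥0∞) : EReal)

/-- The kernel `w ↦ K(w) × ⋯ × K(w)` (`n` factors): `n` conditionally i.i.d. samples from `K`. -/
def iidKernel {𝓦 𝓩 : Type*} [MeasurableSpace 𝓦] [MeasurableSpace 𝓩] (K : Kernel 𝓦 𝓩)
    [IsMarkovKernel K] (n : ℕ) : Kernel 𝓦 (Fin n → 𝓩) where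
  toFun w := Measure.pi fun _ => K w
  measurable' := by
    refine .measure_of_isPiSystem_of_isProbabilityMeasure generateFrom_pi.symm isPiSystem_pi ?_
    rintro _ ⟨s, hs, rfl⟩
    simp only [Measure.pi_pi]
    exact Finset.measurable_prod _ fun i _ => K.measurable_coe (hs i (Set.mem_univ i))

/-- Joint law `P_{W, Zⁿ, Z} = P_W ⊗ (∏ᵢ P_{Zᵢ|W}) ⊗ P_{Z|W}` of the parameter, the dataset and the
fresh sample, where `P_{Zᵢ|W} = P_{Z|W} = K`. -/
def bayesLaw {𝓦 𝓩 : Type*} [MeasurableSpace 𝓦] [MeasurableSpace 𝓩] (PW : Measure 𝓦)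
    (K : Kernel 𝓦 𝓩) [IsMarkovKernel K] (n : ℕ) : Measure (𝓦 × (Fin n → 𝓩) × 𝓩) :=
  PW.compProd ((iidKernel K n).prod K)

/-- The regression model: given `W = w`, the law of `(X, Y)` where `Y = g(X, w) + V`, with `X ∼ P_X`
and `V ∼ N(0, σ²)` independent. -/
def regressionKernel {𝓧 𝓦 : Type*} [MeasurableSpace 𝓧] [MeasurableSpace 𝓦] (PX : Measure 𝓧)
    [IsProbabilityMeasure PX] (σ : ℝ≥0) (g : 𝓧 → 𝓦 → ℝ) (hg : Measurable (Function.uncurry g)) :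
    Kernel 𝓦 (𝓧 × ℝ) where
  toFun w := (PX.prod (gaussianReal 0 (σ ^ 2))).map fun q => (q.1, g q.1 w + q.2)
  measurable' := by
    have h : Measurable fun r : 𝓦 × (𝓧 × ℝ) => (r.2.1, g r.2.1 r.1 + r.2.2) :=
      (measurable_snd.fst).prodMk
        ((hg.comp (measurable_snd.fst.prodMk measurable_fst)).add measurable_snd.snd)
    refine Measure.measurable_of_measurable_coe _ fun s hs => ?_
    have h' (w : 𝓦) : Measurable fun q : 𝓧 × ℝ => (q.1, g q.1 w + q.2) :=
      h.comp measurable_prodMk_left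
    simp_rw [fun w => Measure.map_apply (μ := PX.prod (gaussianReal 0 (σ ^ 2))) (h' w) hs]
    exact measurable_measure_prodMk_left (h hs)

instance {𝓧 𝓦 : Type*} [MeasurableSpace 𝓧] [MeasurableSpace 𝓦] (PX : Measure 𝓧)
    [IsProbabilityMeasure PX] (σ : ℝ≥0) (g : 𝓧 → 𝓦 → ℝ) (hg : Measurable (Function.uncurry g)) :
    IsMarkovKernel (regressionKernel PX σ g hg) where
  isProbabilityMeasure _ := Measure.isProbabilityMeasure_map
    (measurable_fst.prodMk
      ((hg.comp (measurable_fst.prodMk measurable_const)).add measurable_snd)).aemeasurable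

/-- `s_g² = E[sup_{w ∈ 𝓦} ‖∇_w g(X, w)‖²] ∈ [0, ∞]`, where `G x w = ∇_w g(x, w)`. -/
def expSupGradSq {𝓧 F : Type*} [MeasurableSpace 𝓧] [NormedAddCommGroup F] (PX : Measure 𝓧)
    (𝓦 : Set F) (G : 𝓧 → F → F) : ℝ≥0∞ :=
  ∫⁻ x, ⨆ w ∈ 𝓦, ‖G x w‖ₑ ^ 2 ∂PX

end BayesLearning

end

namespace BayesLearning

/-! The last term of the bound suffices: the excess risk is at most `2 * S * H`, where `S` is the
expected supremum of the squared gradient and `H` the Bayes risk of the parameter given the data.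
The fresh noise is centred and independent of everything else, so predicting `Y` costs `σ²` plus the
squared error on `g(X, W)`. Hence knowing `W` costs at least `σ²` (`sq_le_condEntropy_of_hasLaw`),
and a plug-in rule `g(x, d(z))` costs `σ²` plus its mean squared deviation from `g(X, W)`
(`condEntropy_le_of_hasLaw`). As `X` is independent of the parameter and the data, the mean value
inequality bounds this deviation by `S * E‖W - d‖²`. That inequality needs `d` to take values in the
convex set, which an arbitrary estimator need not do. The set is not assumed closed, so the
estimator is moved to a nearly nearest point (`exists_measurable_near_projection`); this costs the
factor 2. If `S = ∞`, only `H = 0` has content: `W` is then almost surely a function of the data,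
and plugging it in needs no gradient bound. -/

lemma enorm_sq_eq_ofReal {F : Type*} [NormedAddCommGroup F] (x : F) :
    ‖x‖ₑ ^ 2 = ENNReal.ofReal (‖x‖ ^ 2) := by
  rw [ENNReal.ofReal_pow (norm_nonneg x), ofReal_norm]

/-- The second moment of a Gaussian `N(0, σ²)` shifted by `c` is `σ² + c²`. -/
lemma lintegral_enorm_add_sq_gaussianReal (σ : ℝ≥0) (c : ℝ) :
    ∫⁻ v, ‖c + v‖ₑ ^ 2 ∂(gaussianReal 0 (σ ^ 2)) = (σ : ℝ≥0∞) ^ 2 + ‖c‖ₑ ^ 2 := by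
  have h1 : Integrable (fun v : ℝ => v) (gaussianReal 0 (σ ^ 2)) :=
    (memLp_id_gaussianReal (μ := 0) (v := σ ^ 2) 1).integrable le_rfl
  have h2 : Integrable (fun v : ℝ => v ^ 2) (gaussianReal 0 (σ ^ 2)) :=
    (memLp_id_gaussianReal (μ := 0) (v := σ ^ 2) 2).integrable_sq
  have hvar : ∫ v, v ^ 2 ∂(gaussianReal 0 (σ ^ 2)) = (σ : ℝ) ^ 2 := by
    have h := variance_fun_id_gaussianReal (μ := 0) (v := σ ^ 2)
    rw [variance_eq_integral measurable_id'.aemeasurable] at h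
    simpa using h
  have hfun : (fun v : ℝ => (c + v) ^ 2) = fun v => c ^ 2 + 2 * c * v + v ^ 2 := by
    funext v; ring
  have h12 : Integrable (fun v : ℝ => c ^ 2 + 2 * c * v) (gaussianReal 0 (σ ^ 2)) :=
    (integrable_const _).add (h1.const_mul _)
  have hint : Integrable (fun v : ℝ => (c + v) ^ 2) (gaussianReal 0 (σ ^ 2)) := by
    rw [hfun]; exact h12.add h2
  have hval : ∫ v, (c + v) ^ 2 ∂(gaussianReal 0 (σ ^ 2)) = (σ : ℝ) ^ 2 + c ^ 2 := by
    -- The cross term `2cv` integrates to zero because the noise is centred.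
    rw [hfun, integral_add h12 h2, integral_add (integrable_const _) (h1.const_mul _),
      integral_const_mul, hvar]
    simp
    ring
  simp_rw [enorm_sq_eq_ofReal, Real.norm_eq_abs, sq_abs]
  rw [← ofReal_integral_eq_lintegral_ofReal hint (ae_of_all _ fun _ => sq_nonneg _), hval,
    ENNReal.ofReal_add (sq_nonneg _) (sq_nonneg _), ENNReal.ofReal_pow σ.coe_nonneg,
    ENNReal.ofReal_coe_nnreal]

instance isMarkovKernel_iidKernel {𝓦 𝓩 : Type*} [MeasurableSpace 𝓦] [MeasurableSpace 𝓩] (K : Kernel 𝓦 𝓩)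
    [IsMarkovKernel K] (n : ℕ) : IsMarkovKernel (iidKernel K n) where
  isProbabilityMeasure _ := by
    change IsProbabilityMeasure (Measure.pi _)
    infer_instance

/-- Integration against the joint law in the regression model, with the noise made explicit. -/
lemma lintegral_bayesLaw_regressionKernel {𝓧 𝓦 : Type*} [MeasurableSpace 𝓧] [MeasurableSpace 𝓦]
    (PW : Measure 𝓦) [SFinite PW] (PX : Measure 𝓧) [IsProbabilityMeasure PX] (σ : ℝ≥0)
    (g : 𝓧 → 𝓦 → ℝ) (hg : Measurable (Function.uncurry g)) (n : ℕ)
    {f : 𝓦 × (Fin n → 𝓧 × ℝ) × (𝓧 × ℝ) → ℝ≥0∞} (hf : Measurable f) :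
    ∫⁻ q, f q ∂(bayesLaw PW (regressionKernel PX σ g hg) n) =
      ∫⁻ w, ∫⁻ z, ∫⁻ x, ∫⁻ v, f (w, z, (x, g x w + v)) ∂(gaussianReal 0 (σ ^ 2)) ∂PX
        ∂(iidKernel (regressionKernel PX σ g hg) n w) ∂PW := by
  rw [bayesLaw, Measure.lintegral_compProd hf]
  refine lintegral_congr fun w => ?_
  have hfw : Measurable fun b => f (w, b) := hf.comp measurable_prodMk_left
  rw [Kernel.prod_apply, lintegral_prod _ hfw.aemeasurable]
  refine lintegral_congr fun z => ?_
  have hfz : Measurable fun b => f (w, z, b) := hfw.comp measurable_prodMk_left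
  have hm : Measurable fun q : 𝓧 × ℝ => (q.1, g q.1 w + q.2) :=
    measurable_fst.prodMk
      ((hg.comp (measurable_fst.prodMk measurable_const)).add measurable_snd)
  change ∫⁻ b, f (w, z, b) ∂((PX.prod (gaussianReal 0 (σ ^ 2))).map _) = _
  rw [lintegral_map hfz hm]
  exact lintegral_prod _ (hfz.comp hm).aemeasurable

/-! ### Analytic tools: near projection, vanishing risk, mean value inequality -/

/-- A measurable, approximately nearest point map into a convex set. -/
lemma exists_measurable_near_projection {F : Type*} [NormedAddCommGroup F] [InnerProductSpace ℝ F]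
    [SecondCountableTopology F] [MeasurableSpace F] [BorelSpace F] {s : Set F} (hs : Convex ℝ s)
    (hne : s.Nonempty) {δ : ℝ} (hδ : 0 < δ) :
    ∃ d : F → F, Measurable d ∧ (∀ y, d y ∈ s) ∧
      ∀ w ∈ s, ∀ y, ‖w - d y‖ ^ 2 ≤ 2 * ‖w - y‖ ^ 2 + δ := by
  classical
  have : Nonempty s := hne.to_subtype
  let e : ℕ → s := TopologicalSpace.denseSeq s
  -- The slack is `δ / 2` because the parallelogram law below doubles it.
  have hex (y : F) : ∃ k, ‖(e k : F) - y‖ ^ 2 < Metric.infDist y s ^ 2 + δ / 2 := by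
    have hlt : Metric.infDist y s < √(Metric.infDist y s ^ 2 + δ / 2) :=
      Real.lt_sqrt_of_sq_lt (by linarith)
    obtain ⟨a, ha, hya⟩ := (Metric.infDist_lt_iff hne).1 hlt
    have hU : IsOpen {a : s | dist y (a : F) < √(Metric.infDist y s ^ 2 + δ / 2)} :=
      isOpen_lt (by fun_prop) continuous_const
    obtain ⟨k, ha'⟩ :=
      (TopologicalSpace.denseRange_denseSeq s).exists_mem_open hU ⟨⟨a, ha⟩, hya⟩
    refine ⟨k, ?_⟩
    rw [← dist_eq_norm, dist_comm]
    exact (Real.lt_sqrt dist_nonneg).1 ha'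
  refine ⟨fun y => e (Nat.find (hex y)), ?_, fun y => (e _).2, fun w hw y => ?_⟩
  · refine Measurable.find (f := fun k _ => (e k : F)) (fun _ => measurable_const)
      (fun k => ?_) hex
    exact measurableSet_lt (by fun_prop) (by fun_prop)
  · have hd := Nat.find_spec (hex y)
    set d : F := ((e (Nat.find (hex y)) : s) : F)
    have hds : d ∈ s := Subtype.prop _
    -- By convexity the midpoint of `w` and `d` is no closer to `y` than the infimum distance. The
    -- parallelogram law then gives `‖w - d‖² ≤ 2‖w - y‖² + 2‖d - y‖² - 4 * infDist²`, and
    -- near-minimality of `d` bounds the last two terms by `δ`.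
    have hmid : (1 / 2 : ℝ) • w + (1 / 2 : ℝ) • d ∈ s :=
      hs hw hds (by norm_num) (by norm_num) (by norm_num)
    have hinf := Metric.infDist_le_dist_of_mem (x := y) hmid
    have hpar := parallelogram_law_with_norm ℝ (w - y) (d - y)
    have e1 : (w - y) - (d - y) = w - d := by abel
    have e2 : (w - y) + (d - y) = (2 : ℝ) • ((1 / 2 : ℝ) • w + (1 / 2 : ℝ) • d - y) := by module
    rw [e1, e2, norm_smul, ← dist_eq_norm _ y, dist_comm _ y, Real.norm_eq_abs] at hpar
    have h0 : 0 ≤ Metric.infDist y s := Metric.infDist_nonneg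
    norm_num at hpar
    nlinarith

/-- If the Bayes risk under the quadratic loss vanishes, then it is attained. -/
lemma exists_ae_eq_of_condEntropy_eq_zero {Ω 𝓤 F : Type*} [MeasurableSpace Ω]
    [MeasurableSpace 𝓤] [NormedAddCommGroup F] [CompleteSpace F] [SecondCountableTopology F]
    [MeasurableSpace F] [BorelSpace F] {P : Measure Ω} {S : Ω → F} {U : Ω → 𝓤}
    (hS : AEMeasurable S P) (hU : AEMeasurable U P)
    (h : condEntropy (A := F) quadLoss S U P = 0) :
    ∃ ψ : 𝓤 → F, Measurable ψ ∧ ∀ᵐ ω ∂P, S ω = ψ (U ω) := by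
  -- Summable risks make the squared errors summable almost surely, so the whole sequence of rules
  -- converges to `S`, with no passage to a subsequence.
  obtain ⟨ε, hε, hsum⟩ := ENNReal.exists_pos_sum_of_countable' (one_ne_zero (α := ℝ≥0∞)) ℕ
  have hex (k : ℕ) : ∃ ψ : 𝓤 → F, Measurable ψ ∧ ∫⁻ ω, ‖S ω - ψ (U ω)‖ₑ ^ 2 ∂P < ε k := by
    have hk : condEntropy (A := F) quadLoss S U P < ε k := h ▸ hε k
    simpa only [condEntropy, quadLoss, iInf_lt_iff, exists_prop] using hk
  choose ψ hψ hψε using hex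
  have hae : ∀ k, AEMeasurable (fun ω => ‖S ω - ψ k (U ω)‖ₑ ^ 2) P := fun k =>
    ((hS.sub ((hψ k).comp_aemeasurable hU)).enorm).pow_const 2
  have hfin : ∫⁻ ω, ∑' k, ‖S ω - ψ k (U ω)‖ₑ ^ 2 ∂P ≠ ∞ := by
    rw [lintegral_tsum hae]
    exact ((ENNReal.tsum_le_tsum fun k => (hψε k).le).trans_lt
      (hsum.trans ENNReal.one_lt_top)).ne
  have htend : ∀ᵐ ω ∂P, Filter.Tendsto (fun k => ψ k (U ω)) Filter.atTop (nhds (S ω)) := by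
    filter_upwards [ae_lt_top' (AEMeasurable.tsum hae) hfin] with ω hω
    have h2 := ENNReal.tendsto_atTop_zero_of_tsum_ne_top hω.ne
    have h1 := (ENNReal.continuous_rpow_const (y := (1 / 2 : ℝ))).continuousAt.tendsto.comp h2
    rw [tendsto_iff_edist_tendsto_0]
    convert h1 using 2 with k
    · simp only [Function.comp, edist_comm _ (S ω), edist_eq_enorm_sub]
      rw [← ENNReal.rpow_natCast, ← ENNReal.rpow_mul]
      norm_num
    · norm_num
  -- Transferring convergence to the law of `U` lets the limit be chosen as a measurable function of
  -- the observation alone.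
  have hmap : ∀ᵐ u ∂(P.map U), ∃ l, Filter.Tendsto (fun k => ψ k u) Filter.atTop (nhds l) := by
    rw [ae_map_iff hU (measurableSet_exists_tendsto hψ)]
    exact htend.mono fun ω hω => ⟨_, hω⟩
  obtain ⟨φ, hφ, hlim⟩ :=
    measurable_limit_of_tendsto_metrizable_ae (fun k => (hψ k).aemeasurable) hmap
  refine ⟨φ, hφ, ?_⟩
  filter_upwards [htend, ae_of_ae_map hU hlim] with ω h1 h2 using tendsto_nhds_unique h1 h2

/-- Mean value inequality on a convex set, in terms of the supremum of the squared gradient. -/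
lemma enorm_sub_sq_le_iSup_gradient {F : Type*} [NormedAddCommGroup F] [InnerProductSpace ℝ F]
    [CompleteSpace F] {s : Set F} (hs : Convex ℝ s) {f : F → ℝ} {f' : F → F}
    (hf : ∀ w ∈ s, HasGradientWithinAt f (f' w) s w) {a b : F} (ha : a ∈ s) (hb : b ∈ s) :
    ‖f a - f b‖ₑ ^ 2 ≤ (⨆ w ∈ s, ‖f' w‖ₑ ^ 2) * ‖a - b‖ₑ ^ 2 := by
  rcases eq_or_ne a b with rfl | hab
  · simp
  rcases eq_or_ne (⨆ w ∈ s, ‖f' w‖ₑ ^ 2) ∞ with htop | htop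
  · have : ‖a - b‖ₑ ^ 2 ≠ 0 := by simpa [sub_eq_zero] using hab
    rw [htop, ENNReal.top_mul this]
    exact le_top
  set M := (⨆ w ∈ s, ‖f' w‖ₑ ^ 2).toReal
  have hM : ENNReal.ofReal M = ⨆ w ∈ s, ‖f' w‖ₑ ^ 2 := ENNReal.ofReal_toReal htop
  have hM0 : 0 ≤ M := ENNReal.toReal_nonneg
  have hbound : ∀ w ∈ s, ‖InnerProductSpace.toDual ℝ F (f' w)‖ ≤ √M := fun w hw => by
    rw [LinearIsometryEquiv.norm_map]
    refine Real.le_sqrt_of_sq_le ?_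
    have h := le_iSup₂ (f := fun w (_ : w ∈ s) => ‖f' w‖ₑ ^ 2) w hw
    rw [← hM, enorm_sq_eq_ofReal] at h
    exact (ENNReal.ofReal_le_ofReal_iff hM0).1 h
  have h := Convex.norm_image_sub_le_of_norm_hasFDerivWithin_le
    (fun w hw => (hf w hw).hasFDerivWithinAt) hbound hs hb ha
  rw [← hM, enorm_sq_eq_ofReal, enorm_sq_eq_ofReal, ← ENNReal.ofReal_mul hM0]
  refine ENNReal.ofReal_le_ofReal ?_
  calc ‖f a - f b‖ ^ 2 ≤ (√M * ‖a - b‖) ^ 2 := pow_le_pow_left₀ (norm_nonneg _) h 2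
    _ = M * ‖a - b‖ ^ 2 := by rw [mul_pow, Real.sq_sqrt hM0]

/-! ### Bayes risks in the regression model -/

section Regression

variable {𝓧 𝓦 Ω : Type*} [MeasurableSpace 𝓧] [MeasurableSpace 𝓦] [MeasurableSpace Ω] {n : ℕ}
  {PW : Measure 𝓦} [IsProbabilityMeasure PW] {PX : Measure 𝓧} [IsProbabilityMeasure PX] {σ : ℝ≥0}
  {g : 𝓧 → 𝓦 → ℝ} {hg : Measurable (Function.uncurry g)}
  {P : Measure Ω} {W : Ω → 𝓦} {Zn : Ω → Fin n → 𝓧 × ℝ} {X : Ω → 𝓧} {Y : Ω → ℝ}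

/-- With the parameter known, the Bayes risk is at least the noise variance. -/
lemma sq_le_condEntropy_of_hasLaw
    (hlaw : HasLaw (fun ω => (W ω, Zn ω, (X ω, Y ω)))
      (bayesLaw PW (regressionKernel PX σ g hg) n) P) :
    (σ : ℝ≥0∞) ^ 2 ≤ condEntropy (A := ℝ) quadLoss Y (fun ω => (X ω, W ω)) P := by
  refine le_iInf₂ fun ψ hψ => ?_
  have hf : Measurable fun q : 𝓦 × (Fin n → 𝓧 × ℝ) × (𝓧 × ℝ) =>
      ‖q.2.2.2 - ψ (q.2.2.1, q.1)‖ₑ ^ 2 := by fun_prop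
  have h := hlaw.lintegral_comp hf.aemeasurable
  rw [lintegral_bayesLaw_regressionKernel PW PX σ g hg n hf] at h
  simp only [quadLoss]
  rw [h]
  -- With the noise split off from `g x w - ψ (x, w)`, the inner integral is `σ²` plus a squared
  -- bias.
  simp_rw [add_sub_right_comm, lintegral_enorm_add_sq_gaussianReal]
  calc (σ : ℝ≥0∞) ^ 2 = ∫⁻ _, ∫⁻ _, ∫⁻ _, (σ : ℝ≥0∞) ^ 2 ∂PX
        ∂(iidKernel (regressionKernel PX σ g hg) n _) ∂PW := by simp
    _ ≤ _ := lintegral_mono fun w => lintegral_mono fun z => lintegral_mono fun x =>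
        le_self_add

/-- The risk of the plug-in rule `(x, z) ↦ g(x, d(z))` bounds the Bayes risk given the data. -/
lemma condEntropy_le_of_hasLaw
    (hlaw : HasLaw (fun ω => (W ω, Zn ω, (X ω, Y ω)))
      (bayesLaw PW (regressionKernel PX σ g hg) n) P)
    {d : (Fin n → 𝓧 × ℝ) → 𝓦} (hd : Measurable d) :
    condEntropy (A := ℝ) quadLoss Y (fun ω => (X ω, Zn ω)) P ≤ (σ : ℝ≥0∞) ^ 2 +
      ∫⁻ w, ∫⁻ z, ∫⁻ x, ‖g x w - g x (d z)‖ₑ ^ 2 ∂PX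
        ∂(iidKernel (regressionKernel PX σ g hg) n w) ∂PW := by
  have hψ : Measurable fun u : 𝓧 × (Fin n → 𝓧 × ℝ) => g u.1 (d u.2) :=
    hg.comp (measurable_fst.prodMk (hd.comp measurable_snd))
  refine (iInf₂_le _ hψ).trans ?_
  have hf : Measurable fun q : 𝓦 × (Fin n → 𝓧 × ℝ) × (𝓧 × ℝ) =>
      ‖q.2.2.2 - g q.2.2.1 (d q.2.1)‖ₑ ^ 2 := by
    have := hψ.comp (g := fun u : 𝓧 × (Fin n → 𝓧 × ℝ) => g u.1 (d u.2))
      (f := fun q : 𝓦 × (Fin n → 𝓧 × ℝ) × (𝓧 × ℝ) => (q.2.2.1, q.2.1)) (by fun_prop)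
    exact ((measurable_snd.snd.snd.sub this).enorm).pow_const 2
  have h := hlaw.lintegral_comp hf.aemeasurable
  rw [lintegral_bayesLaw_regressionKernel PW PX σ g hg n hf] at h
  simp only [quadLoss]
  rw [h]
  simp_rw [add_sub_right_comm, lintegral_enorm_add_sq_gaussianReal]
  simp [lintegral_add_left]

/-- The law of the parameter and the data, as an iterated integral. -/
lemma lintegral_parameter_data_of_hasLaw
    (hlaw : HasLaw (fun ω => (W ω, Zn ω, (X ω, Y ω)))
      (bayesLaw PW (regressionKernel PX σ g hg) n) P)
    {f : 𝓦 → (Fin n → 𝓧 × ℝ) → ℝ≥0∞} (hf : Measurable (Function.uncurry f)) :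
    ∫⁻ ω, f (W ω) (Zn ω) ∂P =
      ∫⁻ w, ∫⁻ z, f w z ∂(iidKernel (regressionKernel PX σ g hg) n w) ∂PW := by
  have hf' : Measurable fun q : 𝓦 × (Fin n → 𝓧 × ℝ) × (𝓧 × ℝ) => f q.1 q.2.1 :=
    hf.comp (measurable_fst.prodMk measurable_snd.fst)
  have h := hlaw.lintegral_comp hf'.aemeasurable
  rw [lintegral_bayesLaw_regressionKernel PW PX σ g hg n hf'] at h
  rw [h]
  simp

end Regression

/-- Bayes risk bound given the data when the expected squared gradient is finite. -/
lemma condEntropy_le_of_expSupGradSq_ne_top {𝓧 Ω F : Type*} [MeasurableSpace 𝓧]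
    [MeasurableSpace Ω] [NormedAddCommGroup F] [InnerProductSpace ℝ F] [CompleteSpace F]
    [SecondCountableTopology F] [MeasurableSpace F] [BorelSpace F] {n : ℕ}
    {𝓦 : Set F} (h𝓦 : Convex ℝ 𝓦) {PW : Measure F} [IsProbabilityMeasure PW]
    (hPW : ∀ᵐ w ∂PW, w ∈ 𝓦) {PX : Measure 𝓧} [IsProbabilityMeasure PX] {σ : ℝ≥0}
    {g : 𝓧 → F → ℝ} {hg : Measurable (Function.uncurry g)} {G : 𝓧 → F → F}
    (hG : ∀ x, ∀ w ∈ 𝓦, HasGradientWithinAt (g x) (G x w) 𝓦 w)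
    {P : Measure Ω} {W : Ω → F} {Zn : Ω → Fin n → 𝓧 × ℝ} {X : Ω → 𝓧} {Y : Ω → ℝ}
    (hlaw : HasLaw (fun ω => (W ω, Zn ω, (X ω, Y ω)))
      (bayesLaw PW (regressionKernel PX σ g hg) n) P)
    (hs : expSupGradSq PX 𝓦 G ≠ ∞) :
    condEntropy (A := ℝ) quadLoss Y (fun ω => (X ω, Zn ω)) P ≤ (σ : ℝ≥0∞) ^ 2 +
      2 * expSupGradSq PX 𝓦 G * condEntropy (A := F) quadLoss W Zn P := by
  set S := expSupGradSq PX 𝓦 G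
  set H := condEntropy (A := F) quadLoss W Zn P with hH
  obtain ⟨w₀, hw₀⟩ := hPW.exists
  have key (ψ : (Fin n → 𝓧 × ℝ) → F) (hψ : Measurable ψ) (δ : ℝ≥0) (hδ : 0 < δ) :
      condEntropy (A := ℝ) quadLoss Y (fun ω => (X ω, Zn ω)) P ≤ (σ : ℝ≥0∞) ^ 2 +
        S * (2 * ∫⁻ ω, ‖W ω - ψ (Zn ω)‖ₑ ^ 2 ∂P + δ) := by
    obtain ⟨d, hd, hds, hnear⟩ :=
      exists_measurable_near_projection h𝓦 ⟨w₀, hw₀⟩ (δ := δ) (by exact_mod_cast hδ)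
    have hm : Measurable (Function.uncurry fun (w : F) (z : Fin n → 𝓧 × ℝ) =>
        ‖w - ψ z‖ₑ ^ 2) := by unfold Function.uncurry; fun_prop
    refine (condEntropy_le_of_hasLaw hlaw (hd.comp hψ)).trans (add_le_add le_rfl ?_)
    rw [lintegral_parameter_data_of_hasLaw hlaw hm]
    calc _ ≤ ∫⁻ w, ∫⁻ z, S * (2 * ‖w - ψ z‖ₑ ^ 2 + δ)
          ∂(iidKernel (regressionKernel PX σ g hg) n w) ∂PW := by
          refine lintegral_mono_ae (hPW.mono fun w hw => lintegral_mono fun z => ?_)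
          have hbd : ‖w - d (ψ z)‖ₑ ^ 2 ≤ 2 * ‖w - ψ z‖ₑ ^ 2 + δ := by
            rw [enorm_sq_eq_ofReal, enorm_sq_eq_ofReal, ← ENNReal.ofReal_ofNat,
              ← ENNReal.ofReal_mul (by norm_num), ← ENNReal.ofReal_coe_nnreal,
              ← ENNReal.ofReal_add (by positivity) δ.coe_nonneg]
            exact ENNReal.ofReal_le_ofReal (hnear w hw _)
          calc _ ≤ ∫⁻ x, (⨆ w ∈ 𝓦, ‖G x w‖ₑ ^ 2) * ‖w - d (ψ z)‖ₑ ^ 2 ∂PX :=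
                lintegral_mono fun x =>
                  enorm_sub_sq_le_iSup_gradient h𝓦 (hG x) hw (hds _)
            -- The supremum over `𝓦` may fail to be measurable in `x`; finiteness of the constant
            -- factor replaces measurability here.
            _ = S * ‖w - d (ψ z)‖ₑ ^ 2 := lintegral_mul_const' _ _ (by simp)
            _ ≤ _ := mul_le_mul_right hbd _
      _ = S * (2 * ∫⁻ w, ∫⁻ z, ‖w - ψ z‖ₑ ^ 2
          ∂(iidKernel (regressionKernel PX σ g hg) n w) ∂PW + δ) := by
          have hin (w : F) : ∫⁻ z, S * (2 * ‖w - ψ z‖ₑ ^ 2 + δ)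
              ∂(iidKernel (regressionKernel PX σ g hg) n w) = S * (2 * ∫⁻ z, ‖w - ψ z‖ₑ ^ 2
              ∂(iidKernel (regressionKernel PX σ g hg) n w) + δ) := by
            rw [lintegral_const_mul' _ _ hs, lintegral_add_right _ measurable_const,
              lintegral_const_mul' _ _ (by simp)]
            simp
          simp_rw [hin]
          rw [lintegral_const_mul' _ _ hs, lintegral_add_right _ measurable_const,
            lintegral_const_mul' _ _ (by simp)]
          simp
  have key' (δ : ℝ≥0) (hδ : 0 < δ) :
      condEntropy (A := ℝ) quadLoss Y (fun ω => (X ω, Zn ω)) P ≤ (σ : ℝ≥0∞) ^ 2 +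
        S * (2 * (H + δ) + δ) := by
    -- When `H = ∞` a constant rule is enough, and keeping `S` as a factor also covers `S = 0`,
    -- where `0 * ∞ = 0`.
    rcases eq_or_ne H ∞ with hHt | hHt
    · refine (key (fun _ => w₀) measurable_const δ hδ).trans ?_
      gcongr
      rw [hHt]; simp
    · have hlt : H < H + δ := ENNReal.lt_add_right hHt (by exact_mod_cast hδ.ne')
      rw [hH] at hlt
      simp only [condEntropy, quadLoss, iInf_lt_iff] at hlt
      obtain ⟨ψ, hψ, h⟩ := hlt
      refine (key ψ hψ δ hδ).trans ?_
      gcongr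
      exact h.le
  -- Letting `δ` tend to 0 uses `S ≠ ∞`: multiplication by `∞` is not continuous at 0.
  have hlim : Filter.Tendsto (fun δ : ℝ≥0 => (σ : ℝ≥0∞) ^ 2 +
      S * (2 * (H + (δ : ℝ≥0∞)) + δ)) (nhdsWithin 0 (Set.Ioi 0))
      (nhds ((σ : ℝ≥0∞) ^ 2 + S * (2 * (H + ((0 : ℝ≥0) : ℝ≥0∞)) + ((0 : ℝ≥0) : ℝ≥0∞)))) := by
    have hc : Continuous fun δ : ℝ≥0 => (δ : ℝ≥0∞) := ENNReal.continuous_coe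
    have h2 : Continuous fun δ : ℝ≥0 => 2 * (H + (δ : ℝ≥0∞)) + δ :=
      ((ENNReal.continuous_const_mul (by simp)).comp (continuous_const.add hc)).add hc
    exact ((continuous_const.add ((ENNReal.continuous_const_mul hs).comp h2)).tendsto 0).mono_left
      nhdsWithin_le_nhds
  have := ge_of_tendsto hlim (eventually_nhdsWithin_of_forall fun δ hδ => key' δ hδ)
  simpa [mul_comm, mul_left_comm, mul_assoc] using this

/-- If the parameter can be estimated from the data without error, then the Bayes risk given the
data is at most the noise variance. -/
lemma condEntropy_le_of_condEntropy_eq_zero {𝓧 Ω F : Type*} [MeasurableSpace 𝓧]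
    [MeasurableSpace Ω] [NormedAddCommGroup F] [CompleteSpace F]
    [SecondCountableTopology F] [MeasurableSpace F] [BorelSpace F] {n : ℕ}
    {PW : Measure F} [IsProbabilityMeasure PW] {PX : Measure 𝓧} [IsProbabilityMeasure PX] {σ : ℝ≥0}
    {g : 𝓧 → F → ℝ} {hg : Measurable (Function.uncurry g)}
    {P : Measure Ω} {W : Ω → F} {Zn : Ω → Fin n → 𝓧 × ℝ} {X : Ω → 𝓧} {Y : Ω → ℝ}
    (hlaw : HasLaw (fun ω => (W ω, Zn ω, (X ω, Y ω)))
      (bayesLaw PW (regressionKernel PX σ g hg) n) P)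
    (hH : condEntropy (A := F) quadLoss W Zn P = 0) :
    condEntropy (A := ℝ) quadLoss Y (fun ω => (X ω, Zn ω)) P ≤ (σ : ℝ≥0∞) ^ 2 := by
  obtain ⟨ψ, hψ, hae⟩ := exists_ae_eq_of_condEntropy_eq_zero
    (measurable_fst.comp_aemeasurable hlaw.aemeasurable)
    (measurable_snd.fst.comp_aemeasurable hlaw.aemeasurable) hH
  have hm : Measurable (Function.uncurry fun (w : F) (z : Fin n → 𝓧 × ℝ) =>
      ‖w - ψ z‖ₑ ^ 2) := by unfold Function.uncurry; fun_prop
  have hz : ∫⁻ ω, ‖W ω - ψ (Zn ω)‖ₑ ^ 2 ∂P = 0 := by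
    rw [lintegral_congr_ae (g := fun _ => 0) (hae.mono fun ω (h : W ω = ψ (Zn ω)) => by simp [h])]
    simp
  rw [lintegral_parameter_data_of_hasLaw hlaw hm,
    lintegral_eq_zero_iff (Measurable.lintegral_kernel_prod_right hm)] at hz
  refine (condEntropy_le_of_hasLaw hlaw hψ).trans ?_
  rw [lintegral_congr_ae (g := fun _ => 0)]
  · simp
  filter_upwards [hz] with w hw
  have hw' := (lintegral_eq_zero_iff (hm.comp measurable_prodMk_left)).1 hw
  rw [lintegral_congr_ae (g := fun _ => 0)]
  · simp
  filter_upwards [hw'] with z hz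
  have : w = ψ z := by simpa [sub_eq_zero] using hz
  simp [← this]

end BayesLearning

theorem mainTheorem8 {𝓧 Ω : Type*} [MeasurableSpace 𝓧] [MeasurableSpace Ω] (p n : ℕ)
    -- the convex parameter set, the prior, the law of the input and the noise level
    (𝓦 : Set (EuclideanSpace ℝ (Fin p))) (h𝓦 : Convex ℝ 𝓦)
    (PW : Measure (EuclideanSpace ℝ (Fin p))) [IsProbabilityMeasure PW]
    (hPW : ∀ᵐ w ∂PW, w ∈ 𝓦)
    (PX : Measure 𝓧) [IsProbabilityMeasure PX] (σ : ℝ≥0)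
    -- the regression function and its gradient in the parameter
    (g : 𝓧 → EuclideanSpace ℝ (Fin p) → ℝ) (hg : Measurable (Function.uncurry g))
    (G : 𝓧 → EuclideanSpace ℝ (Fin p) → EuclideanSpace ℝ (Fin p))
    (hG : ∀ x, ∀ w ∈ 𝓦, HasGradientWithinAt (g x) (G x w) 𝓦 w)
    -- the parameter, the dataset `Zⁿ` and the fresh sample `(X, Y)`
    (P : Measure Ω) (W : Ω → EuclideanSpace ℝ (Fin p)) (Zn : Ω → Fin n → 𝓧 × ℝ)
    (X : Ω → 𝓧) (Y : Ω → ℝ)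
    (hlaw : HasLaw (fun ω => (W ω, Zn ω, (X ω, Y ω)))
      (BayesLearning.bayesLaw PW (BayesLearning.regressionKernel PX σ g hg) n) P) :
    BayesLearning.minExcessRisk (A := ℝ) BayesLearning.quadLoss W Zn X Y P ≤
      (((4 * (σ : ℝ≥0∞) ^ 2 * BayesLearning.expSupGradSq PX 𝓦 G
            * BayesLearning.condEntropy BayesLearning.quadLoss W Zn P) ^ (1 / 2 : ℝ)
          + 2 * BayesLearning.expSupGradSq PX 𝓦 G
            * BayesLearning.condEntropy BayesLearning.quadLoss W Zn P : ℝ≥0∞) : EReal) := by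
  refine EReal.sub_le_of_le_add ?_
  rw [← EReal.coe_ennreal_add, EReal.coe_ennreal_le_coe_ennreal_iff]
  have hlow := BayesLearning.sq_le_condEntropy_of_hasLaw hlaw
  set S := BayesLearning.expSupGradSq PX 𝓦 G
  set H := BayesLearning.condEntropy (A := EuclideanSpace ℝ (Fin p))
    BayesLearning.quadLoss W Zn P
  rw [add_comm]
  -- The square-root term is discarded, and the risk given `W` is replaced by its lower bound `σ²`.
  refine le_trans ?_ (add_le_add hlow le_add_self)
  rcases eq_or_ne H 0 with h0 | h0
  · exact (BayesLearning.condEntropy_le_of_condEntropy_eq_zero hlaw h0).trans le_self_add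
  rcases eq_or_ne S ∞ with htop | htop
  · simp [htop, ENNReal.top_mul h0]
  · exact BayesLearning.condEntropy_le_of_expSupGradSq_ne_top h𝓦 hPW hG hlaw htop
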